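/- Let $\pi$ be a set of primes. A subgroup of a finite group is a $\pi$-subgroup if every prime divisor of its order lies in $\pi$, and a $\pi$-maximal subgroup if it is a $\pi$-subgroup not contained in a strictly larger $\pi$-subgroup. A subgroup $H$ of a finite group $G$ is $\pi$-submaximal in $G$ if $G$ can be embedded as a subnormal subgroup into a finite group $G^*$ such that $H = G \cap K$ for some $\pi$-maximal subgroup $K$ of $G^*$. Let $G$ be a finite group with a unique minimal normal subgroup $V$. Assume that $V$ is a $p$-group for some $p \in \pi$, that $V \not\leq \mathrm{Z}(G)$, and that $G/V$ is a nonabelian simple group. Let $H$ be a $\pi$-submaximal subgroup of $G$, and let $G^*$ be a finite group of minimal order among all finite groups that contain $G$ as a subnormal subgroup and have a $\pi$-maximal subgroup $K$ with $H = G \cap K$. Then $G$ is normal in $G^*$ and $C_{G^*}(G) = 1$. -/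

import Mathlib

universe u v

/-- A subgroup `H` of a finite group is a `π`-subgroup if every prime divisor of `|H|` lies
in `π`. -/
def IsPiSubgroup {G : Type u} [Group G] (π : Set ℕ) (H : Subgroup G) : Prop :=
  ∀ q : ℕ, q.Prime → q ∣ Nat.card H → q ∈ π

/-- A `π`-maximal subgroup: a `π`-subgroup not contained in a strictly larger `π`-subgroup. -/
def IsPiMaximal {G : Type u} [Group G] (π : Set ℕ) (K : Subgroup G) : Prop :=
  IsPiSubgroup π K ∧ ∀ M : Subgroup G, IsPiSubgroup π M → K ≤ M → M = K

/-- A minimal normal subgroup: a nontrivial normal subgroup `V` of `G` such that the only normal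
subgroups of `G` contained in `V` are `1` and `V`. -/
def IsMinimalNormalSubgroup {G : Type u} [Group G] (V : Subgroup G) : Prop :=
  V.Normal ∧ V ≠ ⊥ ∧ ∀ N : Subgroup G, N.Normal → N ≤ V → N = ⊥ ∨ N = V

/-- `φ` embeds `G` into `Gs` as a subnormal subgroup in such a way that, `G` being identified
with its image, `H = G ∩ K` for some `π`-maximal subgroup `K` of `Gs`. -/
def IsPiSubmaximalEmbedding {G : Type u} [Group G] {Gs : Type v} [Group Gs] (π : Set ℕ)
    (H : Subgroup G) (φ : G →* Gs) : Prop :=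
  Function.Injective φ ∧ φ.range.IsSubnormal ∧
    ∃ K : Subgroup Gs, IsPiMaximal π K ∧ H.map φ = φ.range ⊓ K

/-- `H` is `π`-submaximal in `G`: there is a finite group containing `G` as a subnormal subgroup
in which `H` is the intersection of `G` with a `π`-maximal subgroup. -/
def IsPiSubmaximal {G : Type u} [Group G] (π : Set ℕ) (H : Subgroup G) : Prop :=
  ∃ (Gs : Type u) (_ : Group Gs) (_ : Finite Gs) (φ : G →* Gs), IsPiSubmaximalEmbedding π H φ

/-! Identify $G$ with its image, and let $N$, $C$ be its normalizer and centralizer in $G^*$. As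
$Z(G)=1$, $G$ embeds as a normal subgroup of $N/C$; if the trace $H$ can be kept, minimality gives
$|G^*| \le |N/C|$, so $N=G^*$ and $C=1$. Let $K'$ be $\pi$-maximal in $N/C$ above the image of
$K\cap N$. Its trace $Y$ on $G$ contains $H$ and is normalized by $K\cap N$; what is needed is $Y\le
K$ (`IsPiMaximal.le_of_isSimpleGroup_map`). Now $V$ lies in a normal $p$-subgroup $P$ of $G^*$ with
$G\cap P=V$, so $GP/P$ is subnormal and nonabelian simple, and its distinct conjugates commute.
Hence the $K$-conjugates of $YP/P$ generate a $\pi$-group normalized by $K$, which the maximality of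
$K$ absorbs. -/

namespace Subgroup

variable {X : Type*} [Group X]

/-! ### Subnormal subgroups: simple, perfect and $p$-subgroups -/

theorem le_normalizer_of_conj_mem {A B : Subgroup X}
    (h : ∀ a ∈ A, ∀ b ∈ B, a * b * a⁻¹ ∈ B) : A ≤ normalizer (B : Set X) := by
  intro a ha
  rw [mem_normalizer_iff]
  refine fun b => ⟨h a ha b, fun hb => ?_⟩
  have := h a⁻¹ (A.inv_mem ha) _ hb
  simpa [mul_assoc] using this

theorem conj_mem_of_le_normalizer {A B : Subgroup X} (h : A ≤ normalizer (B : Set X))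
    {a b : X} (ha : a ∈ A) (hb : b ∈ B) : a * b * a⁻¹ ∈ B :=
  (mem_normalizer_iff.mp (h ha) b).mp hb

/-- Climb the subnormal chain: $[S,N\cap L]\le N\cap K$ is centralized by $S$, so the three
subgroups lemma and $S=[S,S]$ give $[S,N\cap L]=1$. -/
theorem commutator_eq_bot_of_inf_eq_bot {S N : Subgroup X} (hperf : ⁅S, S⁆ = S)
    (hS : S ≤ normalizer (N : Set X)) {K : Subgroup X} (hK : K.IsSubnormal) (hSK : S ≤ K)
    (h : ⁅S, N ⊓ K⁆ = ⊥) : ⁅S, N⁆ = ⊥ := by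
  induction hK with
  | top => simpa using h
  | step K L hKL hL hn ih =>
    refine ih (hSK.trans hKL) ?_
    rw [normal_subgroupOf_iff_le_normalizer hKL] at hn
    have h1 : ⁅S, N ⊓ L⁆ ≤ N ⊓ K := by
      refine le_inf ((commutator_mono le_rfl inf_le_left).trans
        (le_normalizer_iff_commutator_le_right.mp hS)) ?_
      exact (commutator_mono hSK inf_le_right).trans
        (le_normalizer_iff_commutator_le_left.mp hn)
    have h2 : ⁅⁅S, N ⊓ L⁆, S⁆ = ⊥ := by
      rw [commutator_comm, eq_bot_iff, ← h]
      exact commutator_mono le_rfl h1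
    have h3 : ⁅⁅N ⊓ L, S⁆, S⁆ = ⊥ := by rwa [commutator_comm (N ⊓ L) S]
    have h4 := commutator_commutator_eq_bot_of_rotate h2 h3
    rwa [hperf] at h4

theorem le_or_commutator_eq_bot_of_le_normalizer {S N : Subgroup X} [IsSimpleGroup S]
    (hperf : ⁅S, S⁆ = S) (hsub : S.IsSubnormal) (hS : S ≤ normalizer (N : Set X)) :
    S ≤ N ∨ ⁅S, N⁆ = ⊥ := by
  have hn : (N.subgroupOf S).Normal := by
    rw [← inf_subgroupOf_right, normal_subgroupOf_iff_le_normalizer inf_le_right]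
    refine le_normalizer_of_conj_mem fun a ha b hb => ⟨conj_mem_of_le_normalizer hS ha hb.1, ?_⟩
    exact S.mul_mem (S.mul_mem ha hb.2) (S.inv_mem ha)
  rcases hn.eq_bot_or_eq_top with h | h
  · right
    refine commutator_eq_bot_of_inf_eq_bot hperf hS hsub le_rfl ?_
    rw [subgroupOf_eq_bot, disjoint_iff] at h
    rw [h, commutator_bot_right]
  · exact Or.inl (subgroupOf_eq_top.mp h)

theorem IsSubnormal.le_or_commutator_eq_bot {S K : Subgroup X} [IsSimpleGroup S]
    (hperf : ⁅S, S⁆ = S) (hsub : S.IsSubnormal) (hK : K.IsSubnormal) :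
    S ≤ K ∨ ⁅S, K⁆ = ⊥ := by
  induction hK with
  | top => exact Or.inl le_top
  | step K L hKL hL hn ih =>
    rw [normal_subgroupOf_iff_le_normalizer hKL] at hn
    rcases ih with h | h
    · exact le_or_commutator_eq_bot_of_le_normalizer hperf hsub (h.trans hn)
    · exact Or.inr (eq_bot_iff.mpr (h ▸ commutator_mono le_rfl hKL))

/-- Distinct subnormal nonabelian simple subgroups commute elementwise. -/
theorem IsSubnormal.eq_or_commutator_eq_bot {S T : Subgroup X} [IsSimpleGroup S]
    [IsSimpleGroup T] (hS : ⁅S, S⁆ = S) (hT : ⁅T, T⁆ = T) (hSs : S.IsSubnormal)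
    (hTs : T.IsSubnormal) : S = T ∨ ⁅S, T⁆ = ⊥ := by
  rcases hSs.le_or_commutator_eq_bot hS hTs with h | h
  · rcases hTs.le_or_commutator_eq_bot hT hSs with h' | h'
    · exact Or.inl (le_antisymm h h')
    · exact Or.inr (by rwa [commutator_comm])
  · exact Or.inr h

theorem eq_bot_of_commutator_self_of_isSolvable {E : Subgroup X} [Group.IsSolvable E]
    (hE : ⁅E, E⁆ = E) : E = ⊥ := by
  by_contra hne
  have := (nontrivial_iff_ne_bot E).mpr hne
  have h := Group.IsSolvable.commutator_lt_top_of_nontrivial E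
  refine h.ne (map_injective E.subtype_injective ?_)
  rw [_root_.commutator_def, map_commutator, ← MonoidHom.range_eq_map, range_subtype, hE]

/-- A subnormal subgroup `G` contains every perfect subgroup of `G ⊔ P`, for `P` normal and
solvable. -/
theorem IsSubnormal.le_of_le_sup_of_isSolvable {G P E : Subgroup X} [P.Normal]
    [Group.IsSolvable P] (hE : ⁅E, E⁆ = E) (hEG : E ≤ G ⊔ P) (hG : G.IsSubnormal) : E ≤ G := by
  suffices ∀ K : Subgroup X, K.IsSubnormal → G ≤ K → E ≤ K from this G hG le_rfl
  intro K hK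
  induction hK with
  | top => exact fun _ => le_top
  | step K L hKL hL hn ih =>
    intro hGK
    have hEL := ih (hGK.trans hKL)
    let f := QuotientGroup.mk' (K.subgroupOf L)
    have hsol : Group.IsSolvable ((P.subgroupOf L).map f) := by
      have : Group.IsSolvable (P.subgroupOf L) :=
        Group.isSolvable_of_isSolvable_injective
          (f := (L.subtype.subgroupComap P)) (by
            intro a b h
            exact Subtype.ext (Subtype.ext (congrArg (fun z : P => (z : X)) h)))
      exact Group.isSolvable_of_surjective (f.subgroupMap_surjective (P.subgroupOf L))
    -- Modulo $K\ge G$ the perfect group $E$ falls into the solvable image of $P$, so it vanishes.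
    have hle : (E.subgroupOf L).map f ≤ (P.subgroupOf L).map f := by
      rintro _ ⟨e, he, rfl⟩
      obtain ⟨g, hg, x, hx, hgx⟩ := mem_sup_of_normal_right.mp (hEG he)
      have hgL : g ∈ L := hKL (hGK hg)
      have hxL : x ∈ L := by
        rw [eq_inv_mul_of_mul_eq hgx]
        exact L.mul_mem (L.inv_mem hgL) e.2
      refine ⟨⟨x, hxL⟩, hx, ?_⟩
      have : e = ⟨g, hgL⟩ * ⟨x, hxL⟩ := Subtype.ext hgx.symm
      rw [this, map_mul]
      have : f ⟨g, hgL⟩ = 1 := (QuotientGroup.eq_one_iff _).mpr (hGK hg)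
      rw [this, one_mul]
    have hEsub : ⁅E.subgroupOf L, E.subgroupOf L⁆ = E.subgroupOf L := by
      apply map_injective L.subtype_injective
      rw [map_commutator, map_subgroupOf_eq_of_le hEL, hE]
    have : Group.IsSolvable ((E.subgroupOf L).map f) :=
      Group.isSolvable_of_isSolvable_injective (inclusion_injective hle)
    have hbot := eq_bot_of_commutator_self_of_isSolvable (E := (E.subgroupOf L).map f)
      (by rw [← map_commutator, hEsub])
    rw [map_eq_bot_iff, QuotientGroup.ker_mk'] at hbot
    exact fun e he => hbot (x := ⟨e, hEL he⟩) he

theorem map_conj_eq_of_le_normalizer {A B : Subgroup X} (h : A ≤ normalizer (B : Set X)) {a : X}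
    (ha : a ∈ A) : B.map (MulAut.conj a).toMonoidHom = B := by
  ext x
  constructor
  · rintro ⟨b, hb, rfl⟩
    exact conj_mem_of_le_normalizer h ha hb
  · intro hx
    refine ⟨a⁻¹ * x * a, ?_, by simp [mul_assoc]⟩
    simpa using conj_mem_of_le_normalizer h (A.inv_mem ha) hx

theorem le_normalizer_map_conj {A B : Subgroup X} (h : A ≤ normalizer (B : Set X)) (f : X →* X) :
    A.map f ≤ normalizer (B.map f : Set X) := by
  refine le_normalizer_of_conj_mem ?_
  rintro _ ⟨a, ha, rfl⟩ _ ⟨b, hb, rfl⟩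
  exact ⟨a * b * a⁻¹, conj_mem_of_le_normalizer h ha hb, by simp⟩

/-- A subnormal `p`-subgroup of a finite group lies in a normal `p`-subgroup. -/
theorem IsSubnormal.exists_normal_isPGroup_ge [Finite X] {p : ℕ} {K : Subgroup X}
    (hK : K.IsSubnormal) : ∀ A : Subgroup X, A ≤ K → K ≤ normalizer (A : Set X) →
      IsPGroup p A → ∃ P : Subgroup X, P.Normal ∧ IsPGroup p P ∧ A ≤ P := by
  induction hK with
  | top =>
    intro A _ hn hA
    exact ⟨A, normalizer_eq_top_iff.mp (top_le_iff.mp hn), hA, le_rfl⟩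
  | step K L hKL hL hn ih =>
    intro A hAK hKA hA
    rw [normal_subgroupOf_iff_le_normalizer hKL] at hn
    let Q : Subgroup X → Prop := fun B => B ≤ K ∧ K ≤ normalizer (B : Set X) ∧ IsPGroup p B
    -- Any $L$-conjugate of $B$ is again a $p$-subgroup normalized by $K$; maximality absorbs it, so
    -- $L$ normalizes $B$.
    obtain ⟨B, hAB, hB⟩ := Finite.exists_le_maximal (p := Q) ⟨hAK, hKA, hA⟩
    suffices hLB : L ≤ normalizer (B : Set X) by
      obtain ⟨P, hP, hPp, hBP⟩ := ih B (hB.prop.1.trans hKL) hLB hB.prop.2.2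
      exact ⟨P, hP, hPp, hAB.trans hBP⟩
    refine le_normalizer_of_conj_mem fun l hl b hb => ?_
    let c := (MulAut.conj l).toMonoidHom
    have hKc : K.map c = K := map_conj_eq_of_le_normalizer hn hl
    have hBcK : B.map c ≤ K := (map_mono hB.prop.1).trans hKc.le
    have hKBc : K ≤ normalizer (B.map c : Set X) := by
      have := le_normalizer_map_conj hB.prop.2.1 c
      rwa [hKc] at this
    have hQ : Q (B ⊔ B.map c) := by
      refine ⟨sup_le hB.prop.1 hBcK, ?_, ?_⟩
      · exact (le_inf hB.prop.2.1 hKBc).trans (normalizer_inf_normalizer_le_normalizer_sup _ _)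
      · exact hB.prop.2.2.to_sup_of_normal_right' (hB.prop.2.2.map c) (hB.prop.1.trans hKBc)
    exact hB.le_of_ge hQ le_sup_left (mem_sup_right ⟨b, hb, rfl⟩)

end Subgroup

open Subgroup

/-! ### Closure properties of $\pi$-subgroups -/

namespace IsPiSubgroup

variable {X : Type*} [Group X] {π : Set ℕ}

theorem of_card_dvd {Y : Type*} [Group Y] {A : Subgroup X} {B : Subgroup Y}
    (hB : IsPiSubgroup π B) (h : Nat.card A ∣ Nat.card B) : IsPiSubgroup π A :=
  fun q hq hd => hB q hq (hd.trans h)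

theorem of_card_dvd_mul {Y Z : Type*} [Group Y] [Group Z] {A : Subgroup X} {B : Subgroup Y}
    {C : Subgroup Z} (hB : IsPiSubgroup π B) (hC : IsPiSubgroup π C)
    (h : Nat.card A ∣ Nat.card B * Nat.card C) : IsPiSubgroup π A :=
  fun q hq hd => ((Nat.Prime.dvd_mul hq).mp (hd.trans h)).elim (hB q hq) (hC q hq)

theorem map {Y : Type*} [Group Y] {A : Subgroup X} (hA : IsPiSubgroup π A) (f : X →* Y) :
    IsPiSubgroup π (A.map f) :=
  hA.of_card_dvd (card_map_dvd A f)

theorem of_isPGroup [Finite X] {p : ℕ} (hp : p.Prime) (hpi : p ∈ π) {A : Subgroup X}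
    (hA : IsPGroup p A) : IsPiSubgroup π A := by
  have := Fact.mk hp
  obtain ⟨n, hn⟩ := IsPGroup.iff_card.mp hA
  intro q hq hd
  rw [hn] at hd
  rwa [(Nat.prime_dvd_prime_iff_eq hq hp).mp (hq.dvd_of_dvd_pow hd)]

theorem comap_mk' {P : Subgroup X} [P.Normal] (hP : IsPiSubgroup π P)
    {A : Subgroup (X ⧸ P)} (hA : IsPiSubgroup π A) :
    IsPiSubgroup π (A.comap (QuotientGroup.mk' P)) := by
  have hle : P ≤ A.comap (QuotientGroup.mk' P) :=
    (QuotientGroup.ker_mk' P).symm.le.trans (ker_le_comap _ _)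
  have h : P.relIndex (A.comap (QuotientGroup.mk' P)) = Nat.card A := by
    have hbot : (⊥ : Subgroup (X ⧸ P)).comap (QuotientGroup.mk' P) = P := by
      rw [MonoidHom.comap_bot, QuotientGroup.ker_mk']
    have := relIndex_comap ⊥ (QuotientGroup.mk' P) (A.comap (QuotientGroup.mk' P))
    rw [hbot] at this
    rw [this, map_comap_eq_self_of_surjective (QuotientGroup.mk'_surjective P),
      relIndex_bot_left]
  refine hP.of_card_dvd_mul hA (dvd_of_eq ?_)
  rw [← h, ← relIndex_bot_left, ← relIndex_bot_left, relIndex_mul_relIndex _ _ _ bot_le hle]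

theorem sup {A B : Subgroup X} (hA : IsPiSubgroup π A) (hB : IsPiSubgroup π B)
    (h : A ≤ normalizer (B : Set X)) : IsPiSubgroup π (A ⊔ B) := by
  have key : B.relIndex (A ⊔ B) = B.relIndex A := by
    have hB' : B ≤ normalizer (B : Set X) := le_normalizer
    rw [← relIndex_subgroupOf (sup_le h hB'), ← relIndex_subgroupOf h, subgroupOf_sup h hB',
      relIndex_sup_right]
  refine hB.of_card_dvd_mul hA ?_
  rw [← relIndex_bot_left, ← relIndex_mul_relIndex ⊥ B (A ⊔ B) bot_le le_sup_right, key,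
    relIndex_bot_left]
  exact mul_dvd_mul_left _ (relIndex_dvd_card _ _)

theorem sSup_of_commute {s : Set (Subgroup X)} (hs : s.Finite) (h : ∀ A ∈ s, IsPiSubgroup π A)
    (hc : ∀ A ∈ s, ∀ B ∈ s, A = B ∨ ⁅A, B⁆ = ⊥) : IsPiSubgroup π (sSup s) := by
  induction s, hs using Set.Finite.induction_on with
  | empty =>
    intro q hq hd
    simp at hd
    exact absurd hd hq.ne_one
  | @insert A s hA _ ih =>
    rw [sSup_insert]
    refine (h A (Set.mem_insert _ _)).sup (ih (fun B hB => h B (Set.mem_insert_of_mem _ hB))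
      fun B hB C hC => hc B (Set.mem_insert_of_mem _ hB) C (Set.mem_insert_of_mem _ hC)) ?_
    refine le_trans ?_ (centralizer_le_normalizer _)
    rw [le_centralizer_iff]
    refine sSup_le fun B hB => ?_
    rcases hc B (Set.mem_insert_of_mem _ hB) A (Set.mem_insert _ _) with rfl | h'
    · exact absurd hB hA
    · exact commutator_eq_bot_iff_le_centralizer.mp h'

theorem exists_isPiMaximal_ge [Finite X] {A : Subgroup X} (hA : IsPiSubgroup π A) :
    ∃ K, IsPiMaximal π K ∧ A ≤ K := by
  obtain ⟨K, hAK, hK⟩ := Finite.exists_le_maximal (p := fun B : Subgroup X => IsPiSubgroup π B) hA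
  exact ⟨K, ⟨hK.prop, fun M hM hKM => le_antisymm (hK.le_of_ge hM hKM) hKM⟩, hAK⟩

end IsPiSubgroup

/-! ### Absorption into a $\pi$-maximal subgroup -/

/-- A `π`-subgroup `Y` of the subnormal subgroup `G` that is normalized by `K ⊓ N(G)` lies in the
`π`-maximal subgroup `K`, if `G` is perfect and simple modulo a normal solvable `π`-subgroup. -/
theorem IsPiMaximal.le_of_isSimpleGroup_map {X : Type*} [Group X] [Finite X] {π : Set ℕ}
    {G K P Y : Subgroup X} [P.Normal] [Group.IsSolvable P] (hK : IsPiMaximal π K)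
    (hP : IsPiSubgroup π P) (hG : G.IsSubnormal) (hperf : ⁅G, G⁆ = G)
    (hsimple : IsSimpleGroup (G.map (QuotientGroup.mk' P)))
    (hYG : Y ≤ G) (hY : IsPiSubgroup π Y)
    (hn : K ⊓ normalizer (G : Set X) ≤ normalizer (Y : Set X)) : Y ≤ K := by
  let q := QuotientGroup.mk' P
  let c : X → X →* X := fun k => (MulAut.conj k).toMonoidHom
  have hc : ∀ k l, (c k).comp (c l) = c (k * l) := fun k l => by ext; simp [c]
  have hqc : ∀ k, q.comp (c k) = (MulAut.conj (q k)).toMonoidHom.comp q := fun k => by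
    ext; simp [c]
  have hperf' : ∀ k, ⁅G.map (c k), G.map (c k)⁆ = G.map (c k) := fun k => by
    rw [← map_commutator, hperf]
  have hsub : ∀ k, (G.map (c k)).IsSubnormal := fun k => hG.map (MulAut.conj k).surjective
  have hsimp : ∀ k, IsSimpleGroup ((G.map (c k)).map q) := fun k => by
    rw [map_map, hqc, ← map_map]
    exact ((G.map q).equivMapOfInjective _
      (MulAut.conj (q k)).injective).symm.isSimpleGroup
  have hle : ∀ k l, (G.map (c k)).map q = (G.map (c l)).map q → G.map (c k) ≤ G.map (c l) := by
    intro k l h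
    refine (hsub l).le_of_le_sup_of_isSolvable (P := P) (hperf' k) ?_
    have := (map_le_iff_le_comap.mp h.le)
    rwa [comap_map_eq, QuotientGroup.ker_mk'] at this
  have hcomm : ∀ k ∈ K, ∀ l ∈ K, (Y.map (c k)).map q = (Y.map (c l)).map q ∨
      ⁅(Y.map (c k)).map q, (Y.map (c l)).map q⁆ = ⊥ := by
    intro k hk l hl
    have := hsimp k
    have := hsimp l
    rcases IsSubnormal.eq_or_commutator_eq_bot (S := (G.map (c k)).map q)
      (T := (G.map (c l)).map q) (by rw [← map_commutator, hperf'])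
      (by rw [← map_commutator, hperf']) (hsub k).quotient (hsub l).quotient with h | h
    · left
      -- Equality modulo $P$ lifts because the conjugates of $G$ are perfect and subnormal; so
      -- $l^{-1}k$ normalizes $G$, hence $Y$.
      have heq : G.map (c k) = G.map (c l) := le_antisymm (hle k l h) (hle l k h.symm)
      have hmem : l⁻¹ * k ∈ normalizer (G : Set X) := by
        rw [mem_normalizer_iff_map_conj_eq]
        change G.map (c (l⁻¹ * k)) = G
        rw [← hc, ← map_map, heq, map_map, hc, inv_mul_cancel]
        convert G.map_id
        ext; simp [c]
      have hYeq : Y.map (c (l⁻¹ * k)) = Y :=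
        map_conj_eq_of_le_normalizer hn ⟨K.mul_mem (K.inv_mem hl) hk, hmem⟩
      congr 1
      conv_rhs => rw [← hYeq, map_map, hc, mul_inv_cancel_left]
    · right
      rw [eq_bot_iff, ← h]
      exact commutator_mono (map_mono (map_mono hYG)) (map_mono (map_mono hYG))
  let s : Set (Subgroup (X ⧸ P)) := (fun k => (Y.map (c k)).map q) '' K
  have hW : IsPiSubgroup π (sSup s) := by
    refine IsPiSubgroup.sSup_of_commute (Set.toFinite _) ?_ ?_
    · rintro _ ⟨k, -, rfl⟩
      exact (hY.map _).map _
    · rintro _ ⟨k, hk, rfl⟩ _ ⟨l, hl, rfl⟩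
      exact hcomm k hk l hl
  have hKW : K.map q ≤ normalizer ((sSup s : Subgroup (X ⧸ P)) : Set (X ⧸ P)) := by
    refine le_normalizer_of_conj_mem ?_
    rintro _ ⟨k, hk, rfl⟩ w hw
    suffices sSup s ≤ (sSup s).comap (MulAut.conj (q k)).toMonoidHom from this hw
    refine sSup_le ?_
    rintro _ ⟨l, hl, rfl⟩
    rw [← map_le_iff_le_comap]
    refine le_sSup ⟨k * l, K.mul_mem hk hl, ?_⟩
    change (Y.map (c (k * l))).map q = ((Y.map (c l)).map q).map _
    rw [map_map (Y.map (c l)), ← hqc, ← map_map, ← hc, ← map_map Y]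
  have hM := hK.2 _ (hP.comap_mk' ((hK.1.map q).sup hW hKW))
    (map_le_iff_le_comap.mp le_sup_left)
  rw [← hM, ← map_le_iff_le_comap]
  have h1 : (Y.map (c 1)).map q = Y.map q := by
    congr 1
    convert Y.map_id
    ext; simp [c]
  have hYs : Y.map q ∈ s := ⟨1, K.one_mem, h1⟩
  exact (le_sSup hYs).trans le_sup_right

/-! ### Minimal normal subgroups and the passage to $N/C$ -/

section

variable {G : Type u} [Group G] {V : Subgroup G}

theorem exists_isMinimalNormalSubgroup_le [Finite G] {N : Subgroup G} (hN : N.Normal)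
    (hne : N ≠ ⊥) : ∃ U, IsMinimalNormalSubgroup U ∧ U ≤ N := by
  obtain ⟨U, hUN, hU⟩ := Finite.exists_le_minimal
    (p := fun U : Subgroup G => U.Normal ∧ U ≠ ⊥) ⟨hN, hne⟩
  refine ⟨U, ⟨hU.prop.1, hU.prop.2, fun M hM hMU => ?_⟩, hUN⟩
  by_cases h : M = ⊥
  · exact Or.inl h
  · exact Or.inr (le_antisymm hMU (hU.le_of_le ⟨hM, h⟩ hMU))

theorem Subgroup.eq_or_eq_top_of_normal_of_le [V.Normal] (hsimple : IsSimpleGroup (G ⧸ V))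
    {N : Subgroup G} (hN : N.Normal) (hVN : V ≤ N) : N = V ∨ N = ⊤ := by
  have h : (N.map (QuotientGroup.mk' V)).comap (QuotientGroup.mk' V) = N :=
    comap_map_eq_self (by rwa [QuotientGroup.ker_mk'])
  rcases (hN.map _ (QuotientGroup.mk'_surjective V)).eq_bot_or_eq_top with h' | h'
  · left
    rw [← h, h', MonoidHom.comap_bot, QuotientGroup.ker_mk']
  · right
    rw [← h, h', comap_top]

theorem commutator_eq_top_of_le [V.Normal] (hsimple : IsSimpleGroup (G ⧸ V))
    (hnonab : ∃ a b : G ⧸ V, a * b ≠ b * a) (hle : V ≤ _root_.commutator G) :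
    _root_.commutator G = ⊤ := by
  refine (eq_or_eq_top_of_normal_of_le hsimple inferInstance
    hle).resolve_left fun h => ?_
  obtain ⟨a, b, hab⟩ := hnonab
  obtain ⟨a, rfl⟩ := QuotientGroup.mk'_surjective V a
  obtain ⟨b, rfl⟩ := QuotientGroup.mk'_surjective V b
  refine hab (commutatorElement_eq_one_iff_mul_comm.mp ?_)
  rw [← map_commutatorElement, ← MonoidHom.mem_ker, QuotientGroup.ker_mk', ← h]
  exact commutator_mem_commutator (mem_top a) (mem_top b)

/-- If every `π`-subgroup of `G` that is normalized by `K ⊓ N(G)` lies in `K`, then `G` embeds into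
`N(G) / C(G)` with the same trace `H`. -/
theorem IsPiSubmaximalEmbedding.quotient_centralizer {Gs : Type v} [Group Gs] [Finite Gs]
    {π : Set ℕ} {H : Subgroup G} {φ : G →* Gs} (hinj : Function.Injective φ)
    (hcenter : center G = ⊥) {K : Subgroup Gs} (hK : IsPiMaximal π K)
    (hH : H.map φ = φ.range ⊓ K)
    (hle : ∀ Y ≤ φ.range, IsPiSubgroup π Y →
      K ⊓ normalizer (φ.range : Set Gs) ≤ normalizer (Y : Set Gs) → Y ≤ K) :
    ∃ ψ : G →* normalizer (φ.range : Set Gs) ⧸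
      (centralizer (φ.range : Set Gs)).subgroupOf (normalizer (φ.range : Set Gs)),
      IsPiSubmaximalEmbedding π H ψ := by
  let N := normalizer (φ.range : Set Gs)
  let C := centralizer (φ.range : Set Gs)
  let q := QuotientGroup.mk' (C.subgroupOf N)
  let ι : G →* N := φ.codRestrict N fun g => le_normalizer ⟨g, rfl⟩
  have hψ : Function.Injective (q.comp ι) := by
    rw [injective_iff_map_eq_one]
    intro g hg
    have hgC : φ g ∈ C := (QuotientGroup.eq_one_iff (N := C.subgroupOf N) (ι g)).mp hg
    have : g ∈ center G := by
      rw [mem_center_iff]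
      intro h
      apply hinj
      rw [map_mul, map_mul]
      exact mem_centralizer_iff.mp hgC _ ⟨h, rfl⟩
    rwa [hcenter, mem_bot] at this
  have hιrange : ι.range.Normal := by
    refine ⟨?_⟩
    rintro _ ⟨g, rfl⟩ n
    obtain ⟨g', hg'⟩ := (mem_normalizer_iff.mp n.2 (φ g)).mp ⟨g, rfl⟩
    exact ⟨g', Subtype.ext hg'⟩
  have hKN : IsPiSubgroup π (K.subgroupOf N) :=
    hK.1.of_card_dvd (card_comap_dvd_of_injective K N.subtype N.subtype_injective)
  obtain ⟨K', hK', hKK'⟩ := (hKN.map q).exists_isPiMaximal_ge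
  refine ⟨q.comp ι, hψ, ?_, K', hK', ?_⟩
  · rw [MonoidHom.range_comp]
    exact (hιrange.map q (QuotientGroup.mk'_surjective _)).isSubnormal
  let Y : Subgroup G := K'.comap (q.comp ι)
  have hYpi : IsPiSubgroup π Y := hK'.1.of_card_dvd (card_comap_dvd_of_injective K' _ hψ)
  have hYK : Y.map φ ≤ K := by
    refine hle _ (map_le_range φ Y) (hYpi.map φ) (le_normalizer_of_conj_mem ?_)
    rintro k ⟨hkK, hkN⟩ _ ⟨y, hy, rfl⟩
    obtain ⟨y', hy'⟩ := (mem_normalizer_iff.mp hkN (φ y)).mp ⟨y, rfl⟩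
    refine ⟨y', ?_, hy'⟩
    have hι : ι y' = ⟨k, hkN⟩ * ι y * ⟨k, hkN⟩⁻¹ := Subtype.ext hy'
    change q (ι y') ∈ K'
    have hk : q ⟨k, hkN⟩ ∈ K' := hKK' ⟨⟨k, hkN⟩, hkK, rfl⟩
    rw [hι, map_mul, map_mul, map_inv]
    exact K'.mul_mem (K'.mul_mem hk hy) (K'.inv_mem hk)
  have hHY : H = Y := by
    apply le_antisymm
    · intro h hh
      exact hKK' ⟨ι h, (hH.le ⟨h, hh, rfl⟩).2, rfl⟩
    · rw [← map_le_map_iff_of_injective hinj, hH]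
      exact le_inf (map_le_range φ Y) hYK
  rw [hHY, map_comap_eq]

theorem normalizer_eq_top_and_eq_bot_of_card_le {X : Type*} [Group X] [Finite X]
    {N C : Subgroup X} (hCN : C ≤ N)
    (h : Nat.card X ≤ Nat.card (N ⧸ C.subgroupOf N)) : N = ⊤ ∧ C = ⊥ := by
  have h1 : Nat.card (N ⧸ C.subgroupOf N) * Nat.card C = Nat.card N := by
    rw [card_eq_card_quotient_mul_card_subgroup (C.subgroupOf N),
      Nat.card_congr (subgroupOfEquivOfLe hCN).toEquiv]
  have h2 : Nat.card N ≤ Nat.card X := N.card_le_card_group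
  have h3 : 0 < Nat.card C := Nat.card_pos
  have h4 : 0 < Nat.card X := Nat.card_pos
  constructor
  · apply eq_top_of_le_card
    nlinarith
  · apply eq_bot_of_card_le
    nlinarith

end

/-! ### The main theorem -/

theorem proposition1 {G : Type u} [Group G] [Finite G]
    (π : Set ℕ) (hπ : ∀ q ∈ π, q.Prime)
    -- `V` is the unique minimal normal subgroup of `G`
    (V : Subgroup G) [V.Normal] (hV : IsMinimalNormalSubgroup V)
    (hVuniq : ∀ U : Subgroup G, IsMinimalNormalSubgroup U → U = V)
    (p : ℕ) (hp : p ∈ π) (hVp : IsPGroup p V)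
    (hVZ : ¬ V ≤ Subgroup.center G)
    -- `G / V` is nonabelian simple
    (hsimple : IsSimpleGroup (G ⧸ V)) (hnonab : ∃ a b : G ⧸ V, a * b ≠ b * a)
    (H : Subgroup G) (hH : IsPiSubmaximal π H)
    -- `Gs` is a finite group containing `G` (through `φ`) as required, of minimal order
    {Gs : Type u} [Group Gs] [Finite Gs] (φ : G →* Gs)
    (hφ : IsPiSubmaximalEmbedding π H φ)
    (hmin : ∀ (G' : Type u) [Group G'] [Finite G'] (ψ : G →* G'),
      IsPiSubmaximalEmbedding π H ψ → Nat.card Gs ≤ Nat.card G') :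
    φ.range.Normal ∧ Subgroup.centralizer (φ.range : Set Gs) = ⊥ := by
  obtain ⟨hinj, hsub, K, hK, hHK⟩ := hφ
  have hprime := hπ p hp
  have := Fact.mk hprime
  have hVle : ∀ N : Subgroup G, N.Normal → N ≠ ⊥ → V ≤ N := fun N hN hne => by
    obtain ⟨U, hU, hUN⟩ := exists_isMinimalNormalSubgroup_le hN hne
    exact hVuniq U hU ▸ hUN
  have hcenter : center G = ⊥ := by
    by_contra hne
    exact hVZ (hVle _ inferInstance hne)
  have hperf : _root_.commutator G = ⊤ := by
    refine commutator_eq_top_of_le hsimple hnonab (hVle _ inferInstance fun h => hVZ ?_)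
    rw [_root_.commutator_def, commutator_top_right_eq_bot_iff_le_center] at h
    exact le_top.trans h
  have hperf' : ⁅φ.range, φ.range⁆ = φ.range := by
    rw [MonoidHom.range_eq_map, ← map_commutator, ← _root_.commutator_def, hperf]
  have hntop : ∀ N : Subgroup G, IsPGroup p N → N ≠ ⊤ := by
    rintro N hN rfl
    have : Group.IsNilpotent (⊤ : Subgroup G) := hN.isNilpotent
    have htop := eq_bot_of_commutator_self_of_isSolvable (E := (⊤ : Subgroup G)) hperf
    exact hV.2.1 (eq_bot_iff.mpr (htop ▸ le_top))
  obtain ⟨P, hPn, hPp, hVP⟩ := hsub.exists_normal_isPGroup_ge (p := p) (V.map φ)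
    (map_le_range φ V) (by
      rw [MonoidHom.range_eq_map]
      refine le_trans ?_ (le_normalizer_map φ)
      rw [normalizer_eq_top]) (hVp.map φ)
  have : Group.IsNilpotent P := hPp.isNilpotent
  -- $G\cap P$ is $V$ or $G$, and the nontrivial perfect group $G$ is not a $p$-group.
  have hker : ((QuotientGroup.mk' P).comp φ).ker = V := by
    rw [← MonoidHom.comap_ker, QuotientGroup.ker_mk']
    refine (eq_or_eq_top_of_normal_of_le hsimple (hPn.comap φ)
      (map_le_iff_le_comap.mp hVP)).resolve_right (hntop _ ?_)
    exact hPp.comap_of_injective φ hinj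
  have hS : IsSimpleGroup (φ.range.map (QuotientGroup.mk' P)) := by
    rw [← MonoidHom.range_comp]
    exact ((QuotientGroup.quotientMulEquivOfEq hker.symm).trans
      (QuotientGroup.quotientKerEquivRange _)).symm.isSimpleGroup
  obtain ⟨ψ, hψ⟩ := IsPiSubmaximalEmbedding.quotient_centralizer hinj hcenter hK hHK
    fun Y hYG hY hn => hK.le_of_isSimpleGroup_map (.of_isPGroup hprime hp hPp) hsub hperf' hS
      hYG hY hn
  have := normalizer_eq_top_and_eq_bot_of_card_le (centralizer_le_normalizer _) (hmin _ ψ hψ)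
  exact ⟨normalizer_eq_top_iff.mp this.1, this.2⟩
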